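/- Let $n$ and $r$ be positive integers. Let $\Omega_{n,r} = \{a^c : 1 \le a \le n,\ c \in \mathbb{Z}_r\}$ be the set of $r$-colored integers, where the colors $c \in \mathbb{Z}_r$ are represented by $0,1,\dots,r-1$, and let $\mathfrak{S}_{n,r}$ be the group of all permutations $w$ of $\Omega_{n,r}$ such that $w(a^0)=b^j$ implies $w(a^i)=b^{i+j}$ for all $i \in \mathbb{Z}_r$. Write $w(i^0) = w_i^{c_i}$ for $1 \le i \le n$, with $w_i \in \{1,\dots,n\}$ and $0 \le c_i \le r-1$. The color order on $\Omega_{n,r}$ is $$1^{r-1} <_c \cdots <_c n^{r-1} <_c \cdots <_c 1^1 <_c \cdots <_c n^1 <_c 1^0 <_c \cdots <_c n^0 .$$ Let $\mathrm{Des}(w)$ be the set of all $i \in \{1,\dots,n-1\}$ with $w_i^{c_i} >_c w_{i+1}^{c_{i+1}}$, together with $0$ if $c_1 \ne 0$. Put $\mathrm{des}(w) = |\mathrm{Des}(w)|$ and $\mathrm{fmaj}(w) = r \sum_{i \in \mathrm{Des}(w)} i + \sum_{i=1}^n c_i$. Let $\mathcal{D}_n^r$ be the set of colored derangements, that is, of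 all $w \in \mathfrak{S}_{n,r}$ such that $w(a^0) \neq a^0$ for every $1 \le a \le n$. Then, as formal power series in $x$ with coefficients in $\mathbb{Z}[q]$, $$\sum_{m \ge 0} \, \sum_{k=0}^n (-1)^k q^{r\binom{k}{2}} \binom{m+1}{k}_{q^r} [rm+1]_q^{\,n-k} \, x^m \;=\; \frac{\sum_{w \in \mathcal{D}_n^r} x^{\mathrm{des}(w)} q^{\mathrm{fmaj}(w)}}{(x;q^r)_{n+1}},$$ where $[N]_q = 1+q+\cdots+q^{N-1}$, $[N]_q! = [1]_q[2]_q\cdots[N]_q$, $\binom{N}{k}_q = \frac{[N]_q!}{[k]_q!\,[N-k]_q!}$ for $0 \le k \le N$ and $\binom{N}{k}_q = 0$ for $k > N$, and $(x;q)_N = \prod_{i=0}^{N-1} (1-xq^i)$. -/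

import Mathlib

open Polynomial

/-- The set `Ω_{n,r}` of `r`-colored integers: `(a, c)` stands for `(a+1)^c`. -/
abbrev ColoredInt (n r : ℕ) : Type := Fin n × ZMod r

/-- The `r`-colored permutation group: the permutations `w` of `Ω_{n,r}` such that
`w(a^0) = b^j` implies `w(a^i) = b^(i+j)`. -/
def coloredPermGroup (n r : ℕ) : Subgroup (Equiv.Perm (ColoredInt n r)) where
  carrier := {w | ∀ (a b : Fin n) (j : ZMod r), w (a, 0) = (b, j) →
    ∀ i : ZMod r, w (a, i) = (b, i + j)}
  one_mem' := by
    intro a b j h i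
    simp only [Equiv.Perm.one_apply, Prod.mk.injEq] at h ⊢
    exact ⟨h.1, by rw [← h.2, add_zero]⟩
  mul_mem' := by
    intro u v hu hv a b j h i
    have hv' := hv a (v (a, 0)).1 (v (a, 0)).2 rfl
    have hu' := hu (v (a, 0)).1 (u ((v (a, 0)).1, 0)).1 (u ((v (a, 0)).1, 0)).2 rfl
    simp only [Equiv.Perm.mul_apply] at h ⊢
    rw [hv', hu'] at h ⊢
    simp only [Prod.mk.injEq] at h ⊢
    refine ⟨h.1, ?_⟩
    rw [← h.2]
    ring
  inv_mem' := by
    intro w hw a b j h i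
    rw [Equiv.Perm.inv_eq_iff_eq] at h ⊢
    have hw' := hw b (w (b, 0)).1 (w (b, 0)).2 rfl
    rw [hw'] at h ⊢
    simp only [Prod.mk.injEq] at h ⊢
    refine ⟨h.1, ?_⟩
    rw [add_assoc, ← h.2, add_zero]

namespace ColoredPerm

variable {n r : ℕ}

/-- The letter in the window notation of `w` at the (zero-based) position `i`: its first component
is the value of the underlying permutation, its second component the color. -/
def letter (w : coloredPermGroup n r) (i : Fin n) : ColoredInt n r :=
  (w : Equiv.Perm (ColoredInt n r)) (i, 0)

/-- The (strict) color order
`1^(r-1) < ⋯ < n^(r-1) < ⋯ < 1^1 < ⋯ < n^1 < 1^0 < ⋯ < n^0`,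
where colors are represented by `0, …, r-1`. -/
def ColorLT (x y : ColoredInt n r) : Prop :=
  y.2.val < x.2.val ∨ (x.2.val = y.2.val ∧ x.1 < y.1)

open Classical in
/-- The descent set, a subset of `{0, …, n-1}`: the indices `1 ≤ i ≤ n-1` such that the `i`-th letter
exceeds the `(i+1)`-st one (at the zero-based positions `i-1` and `i`) in the color order, together
with `0` if the first letter has nonzero color. -/
noncomputable def descentSet (w : coloredPermGroup n r) : Finset ℕ :=
  (Finset.range n).filter fun i =>
    (i = 0 ∧ ∃ h : 0 < n, (letter w ⟨0, h⟩).2 ≠ 0) ∨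
    (1 ≤ i ∧ ∃ h : i < n, ColorLT (letter w ⟨i, h⟩) (letter w ⟨i - 1, by omega⟩))

/-- The number of descents. -/
noncomputable def des (w : coloredPermGroup n r) : ℕ := (descentSet w).card

/-- The major index, the sum of all descents. -/
noncomputable def maj (w : coloredPermGroup n r) : ℕ := ∑ i ∈ descentSet w, i

/-- The sum of the colors (taken in `{0, …, r-1}`) of all letters. -/
def csum (w : coloredPermGroup n r) : ℕ := ∑ i : Fin n, (letter w i).2.val

/-- The flag major index. -/
noncomputable def fmaj (w : coloredPermGroup n r) : ℕ := r * maj w + csum w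

open Classical in
/-- The colored derangements: the colored permutations without fixed points of color zero. -/
noncomputable def derangements (n r : ℕ) [NeZero r] : Finset (coloredPermGroup n r) :=
  Finset.univ.filter fun w => ∀ a : Fin n, letter w a ≠ (a, 0)

end ColoredPerm

namespace QAnalog

/-- `[n]_q = 1 + q + ⋯ + q^(n-1)`. -/
def qInt {R : Type*} [CommRing R] (q : R) (n : ℕ) : R := ∑ i ∈ Finset.range n, q ^ i

/-- `[n]_q! = [1]_q [2]_q ⋯ [n]_q`. -/
def qFactorial {R : Type*} [CommRing R] (q : R) (n : ℕ) : R :=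
  ∏ i ∈ Finset.range n, qInt q (i + 1)

/-- `(x; q)_n = (1 - x) (1 - x q) ⋯ (1 - x q^(n-1))`. -/
def qPochhammer {R : Type*} [CommRing R] (x q : R) (n : ℕ) : R :=
  ∏ i ∈ Finset.range n, (1 - x * q ^ i)

/-- The `q`-binomial coefficient `[n]_q! / ([k]_q! [n-k]_q!)` as a polynomial in the indeterminate
`q = X`, and `0` for `k > n`. The denominator is monic and the division is exact, see
`qBinomial_mul`. -/
noncomputable def qBinomial (n k : ℕ) : ℤ[X] :=
  if k ≤ n then
    qFactorial (X : ℤ[X]) n /ₘ (qFactorial (X : ℤ[X]) k * qFactorial (X : ℤ[X]) (n - k))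
  else 0

theorem qFactorial_succ {R : Type*} [CommRing R] (q : R) (n : ℕ) :
    qFactorial q (n + 1) = qFactorial q n * qInt q (n + 1) :=
  Finset.prod_range_succ _ _

theorem qInt_add {R : Type*} [CommRing R] (q : R) (a b : ℕ) :
    qInt q (a + b) = qInt q a + q ^ a * qInt q b := by
  simp only [qInt, Finset.sum_range_add, Finset.mul_sum, pow_add]

theorem qFactorial_X_monic (n : ℕ) : (qFactorial (X : ℤ[X]) n).Monic :=
  Polynomial.monic_prod_of_monic _ _ fun i _ => by
    have h := Polynomial.monic_geom_sum_X (R := ℤ) (n := i + 1) (by omega)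
    exact h

theorem qFactorial_mul_dvd {R : Type*} [CommRing R] (q : R) (a b : ℕ) :
    qFactorial q a * qFactorial q b ∣ qFactorial q (a + b) := by
  induction a generalizing b with
  | zero => simp [qFactorial]
  | succ a iha =>
    induction b with
    | zero => simp [qFactorial]
    | succ b ihb =>
      have h1 : qFactorial q (a + 1 + (b + 1)) =
          qFactorial q (a + (b + 1)) * qInt q (a + 1)
            + qFactorial q (a + 1 + b) * (q ^ (a + 1) * qInt q (b + 1)) := by
        rw [show a + 1 + (b + 1) = (a + 1 + b) + 1 by ring, qFactorial_succ,
          show a + 1 + b + 1 = (a + 1) + (b + 1) by ring, qInt_add,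
          show a + (b + 1) = a + 1 + b by ring]
        ring
      rw [h1]
      refine dvd_add ?_ ?_
      · rw [qFactorial_succ q a, mul_right_comm]
        exact mul_dvd_mul_right (iha (b + 1)) _
      · rw [qFactorial_succ q b, ← mul_assoc]
        exact mul_dvd_mul ihb (dvd_mul_left _ _)

theorem qBinomial_mul {n k : ℕ} (hk : k ≤ n) :
    qBinomial n k * (qFactorial X k * qFactorial X (n - k)) = qFactorial X n := by
  have hm := (qFactorial_X_monic k).mul (qFactorial_X_monic (n - k))
  have hd := qFactorial_mul_dvd (X : ℤ[X]) k (n - k)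
  rw [Nat.add_sub_cancel' hk] at hd
  rw [qBinomial, if_pos hk, mul_comm]
  have h := Polynomial.modByMonic_add_div (qFactorial (X : ℤ[X]) n)
    (qFactorial (X : ℤ[X]) k * qFactorial (X : ℤ[X]) (n - k))
  rwa [(Polynomial.modByMonic_eq_zero_iff_dvd hm).2 hd, zero_add] at h

/-- `1 / (x; p)_N` as a formal power series in `x`, see `qPochhammer_mul_inv`. -/
noncomputable def qPochhammerInv {R : Type*} [CommRing R] (p : R) (N : ℕ) : PowerSeries R :=
  PowerSeries.invOfUnit (qPochhammer PowerSeries.X (PowerSeries.C p) N) 1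

theorem qPochhammer_mul_inv {R : Type*} [CommRing R] (p : R) (N : ℕ) :
    qPochhammer PowerSeries.X (PowerSeries.C p) N * qPochhammerInv p N = 1 := by
  apply PowerSeries.mul_invOfUnit
  simp [qPochhammer, map_prod]

end QAnalog

/-! Fix `m` and compare coefficients of `x ^ m`. Both sides count words `f` of length `n` with
letters in `0, …, r * m`, weighted by `q` to the sum of the letters, in which no multiple of `r` is
a fixed value. Here `v` is a fixed value if some occurrence of `v` keeps its position when `f` is
sorted stably in decreasing order.

Left side: a prescribed value `v` can be inserted into any word as a fixed value in exactly one way,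
and this neither creates nor destroys other fixed values (`exists_balanced`, `insert_unique`,
`delete_unique`, `hasFixed_insert`). Hence the words in which all elements of a set `S` of size `k`
are fixed values have total weight `q ^ (∑ v ∈ S, v) * [r * m + 1] ^ (n - k)` for `k ≤ n`, and 0
otherwise. Inclusion-exclusion over subsets of `{0, r, …, r * m}` gives the alternating sum, the
subset sums being `q`-binomials (`sum_powersetCard_image_mul`).

Right side: send `f` to its sorting permutation, colored by the residues of the letters modulo `r`.
In sorted order the quotients by `r`, preceded by `m`, decrease weakly, and strictly exactly where a
descent forces it. Their successive differences are therefore arbitrary subject to lower bounds 0 or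
1, so each fibre contributes one summand of the numerator over `(x; q ^ r)_{n+1}` (`sum_ofWord_eq`).
Fixed values divisible by `r` correspond to fixed points of color 0 (`ofWord_mem_derangements_iff`).
-/

namespace FixedValue

/-! ### Inserting and deleting fixed values. -/

/-- `v` can be inserted between `A` and `B` as a fixed point of the decreasing rearrangement. -/
def Balanced (v : ℕ) (A B : List ℕ) : Prop :=
  A.countP (fun x => x < v) = B.countP (fun x => v < x)

/-- Some occurrence of `v` in `L` does not move when `L` is sorted (stably) in decreasing order. -/
def HasFixed (v : ℕ) (L : List ℕ) : Prop :=
  ∃ A B, L = A ++ v :: B ∧ Balanced v A B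

/-- Discrete continuity: moving the cut one letter to the right raises the left count minus the
right count by 0 or 1, and at the right end the difference is nonnegative. -/
theorem exists_balanced_of_le (v : ℕ) (B : List ℕ) : ∀ A : List ℕ,
    A.countP (fun x => x < v) ≤ B.countP (fun x => v < x) →
    ∃ A' B', A ++ B = A' ++ B' ∧ Balanced v A' B' := by
  induction B with
  | nil => intro A h; exact ⟨A, [], rfl, le_antisymm h (by simp)⟩
  | cons x B ih =>
    intro A h
    rcases h.eq_or_lt with h | h
    · exact ⟨A, _, rfl, h⟩
    · obtain ⟨A', B', h1, h2⟩ := ih (A ++ [x]) (by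
        simp only [List.countP_append, List.countP_cons, List.countP_nil, decide_eq_true_eq] at h ⊢
        split_ifs at h ⊢ <;> omega)
      exact ⟨A', B', by simpa using h1, h2⟩

theorem exists_balanced (v : ℕ) (L : List ℕ) : ∃ A B, L = A ++ B ∧ Balanced v A B :=
  exists_balanced_of_le v L [] (by simp)

theorem cons_eq_append_singleton {v : ℕ} {C : List ℕ}
    (h1 : C.countP (fun x => x < v) = 0) (h2 : C.countP (fun x => v < x) = 0) :
    v :: C = C ++ [v] := by
  have hC : C = List.replicate C.length v := by
    rw [List.eq_replicate_iff]
    refine ⟨rfl, fun x hx => ?_⟩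
    simp only [List.countP_eq_zero, decide_eq_true_eq] at h1 h2
    have := h1 x hx
    have := h2 x hx
    omega
  rw [hC, ← List.replicate_succ, List.replicate_succ']

/-- Subtracting the two balance equations shows that the stretch `C` between the cuts has no letter
below or above `v`. It consists of copies of `v`, so a further `v` may stand at either end of it. -/
theorem insert_unique {v : ℕ} {A B A' B' : List ℕ} (h : A ++ B = A' ++ B')
    (hb : Balanced v A B) (hb' : Balanced v A' B') : A ++ v :: B = A' ++ v :: B' := by
  have key : ∀ {A C B : List ℕ}, Balanced v A (C ++ B) → Balanced v (A ++ C) B →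
      A ++ v :: (C ++ B) = A ++ C ++ v :: B := by
    intro A C B h1 h2
    simp only [Balanced, List.countP_append] at h1 h2
    have := cons_eq_append_singleton (v := v) (C := C) (by omega) (by omega)
    rw [← List.cons_append, this]
    simp
  rcases List.append_eq_append_iff.1 h with ⟨C, rfl, rfl⟩ | ⟨C, rfl, rfl⟩
  · exact key hb hb'
  · exact (key hb' hb).symm

theorem delete_unique {v : ℕ} {A B A' B' : List ℕ} (h : A ++ v :: B = A' ++ v :: B')
    (hb : Balanced v A B) (hb' : Balanced v A' B') : A ++ B = A' ++ B' := by
  have key : ∀ {A C A' B B' : List ℕ}, A' = A ++ C → v :: B = C ++ v :: B' →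
      Balanced v A B → Balanced v A' B' → A ++ B = A' ++ B' := by
    intro A C A' B B' hA hB h1 h2
    cases C with
    | nil => simp_all
    | cons c C =>
      simp only [List.cons_append, List.cons.injEq] at hB
      obtain ⟨rfl, rfl⟩ := hB
      subst hA
      simp only [Balanced, List.countP_append, List.countP_cons, lt_irrefl, decide_false] at h1 h2
      have := cons_eq_append_singleton (v := v) (C := C) (by simp at h1 h2; omega)
        (by simp at h1 h2; omega)
      rw [this]
      simp
  rcases List.append_eq_append_iff.1 h with ⟨C, h1, h2⟩ | ⟨C, h1, h2⟩
  · exact key h1 h2 hb hb'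
  · exact (key h1 h2 hb' hb).symm

theorem countP_lt_mono {u v : ℕ} (h : u ≤ v) (L : List ℕ) :
    L.countP (fun x => x < u) ≤ L.countP (fun x => x < v) :=
  List.countP_mono_left fun x _ hx => by
    simp only [decide_eq_true_eq] at hx ⊢; omega

theorem countP_gt_mono {u v : ℕ} (h : u ≤ v) (L : List ℕ) :
    L.countP (fun x => v < x) ≤ L.countP (fun x => u < x) :=
  List.countP_mono_left fun x _ hx => by
    simp only [decide_eq_true_eq] at hx ⊢; omega

theorem append_cons_eq_append_cons {u : ℕ} {A B C D : List ℕ} (h : A ++ B = C ++ u :: D) :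
    (∃ E, A = C ++ u :: E ∧ D = E ++ B) ∨ (∃ E, B = E ++ u :: D ∧ C = A ++ E) := by
  rcases List.append_eq_append_iff.1 h with ⟨E, h1, h2⟩ | ⟨E, h1, h2⟩
  · exact Or.inr ⟨E, h2, h1⟩
  · cases E with
    | nil => exact Or.inr ⟨[], by simpa using h2.symm, by simpa using h1.symm⟩
    | cons e E =>
      simp only [List.cons_append, List.cons.injEq] at h2
      obtain ⟨rfl, rfl⟩ := h2
      exact Or.inl ⟨E, h1, rfl⟩

/-- The right side does not involve `k`, so copies of `v` at a balanced cut do not affect whether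
`u` is fixed. A fixed `u < v` must lie to the right of the cut and a fixed `u > v` to the left, by
comparing the two balance equations. On that side the copies of `v` are not counted for `u`. -/
theorem hasFixed_append_replicate {u v : ℕ} (huv : u ≠ v) {A B : List ℕ} (hb : Balanced v A B)
    (k : ℕ) : HasFixed u (A ++ (List.replicate k v ++ B)) ↔
      (u < v ∧ ∃ C D, B = C ++ u :: D ∧ Balanced u (A ++ C) D) ∨
      (v < u ∧ ∃ C D, A = C ++ u :: D ∧ Balanced u C (D ++ B)) := by
  unfold HasFixed
  constructor
  · rintro ⟨C, D, h, hu⟩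
    rcases append_cons_eq_append_cons h with ⟨E, rfl, rfl⟩ | ⟨E, hE, rfl⟩
    · rcases lt_or_gt_of_ne huv with hlt | hlt
      · exfalso
        have h1 := countP_lt_mono hlt.le C
        have h2 := countP_gt_mono hlt.le B
        simp only [Balanced, List.countP_append, List.countP_cons, decide_eq_true_eq,
          if_pos hlt] at hb hu
        omega
      · refine Or.inr ⟨hlt, C, E, rfl, ?_⟩
        simpa [Balanced, List.countP_append, List.countP_replicate, hlt.le.not_gt] using hu
    · rcases append_cons_eq_append_cons hE with ⟨F, hF, rfl⟩ | ⟨F, rfl, rfl⟩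
      · exact absurd (List.eq_of_mem_replicate (n := k) (a := v) (by rw [hF]; simp)) huv
      · rcases lt_or_gt_of_ne huv with hlt | hlt
        · refine Or.inl ⟨hlt, F, D, rfl, ?_⟩
          simpa [Balanced, List.countP_append, List.countP_replicate, hlt.le.not_gt] using hu
        · exfalso
          have h1 := countP_lt_mono hlt.le A
          have h2 := countP_gt_mono hlt.le D
          simp only [Balanced, List.countP_append, List.countP_cons, decide_eq_true_eq,
            if_pos hlt] at hb hu
          omega
  · rintro (⟨hlt, C, D, rfl, hu⟩ | ⟨hlt, C, D, rfl, hu⟩)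
    · refine ⟨A ++ (List.replicate k v ++ C), D, by simp, ?_⟩
      simpa [Balanced, List.countP_append, List.countP_replicate, hlt.le.not_gt] using hu
    · refine ⟨C, D ++ (List.replicate k v ++ B), by simp, ?_⟩
      simpa [Balanced, List.countP_append, List.countP_replicate, hlt.le.not_gt] using hu

theorem hasFixed_insert {u v : ℕ} {A B : List ℕ} (hb : Balanced v A B) :
    HasFixed u (A ++ v :: B) ↔ u = v ∨ HasFixed u (A ++ B) := by
  by_cases huv : u = v
  · subst huv
    exact ⟨fun _ => Or.inl rfl, fun _ => ⟨A, B, rfl, hb⟩⟩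
  · have h1 := hasFixed_append_replicate huv hb 1
    have h0 := hasFixed_append_replicate huv hb 0
    simp only [List.replicate_one, List.singleton_append, List.replicate_zero,
      List.nil_append] at h0 h1
    rw [h1, h0]
    simp [huv]

/-! ### Weighted counts of words by their fixed values. -/

/-- The lists of length `n` with entries at most `M`. -/
def words (M n : ℕ) : Finset (List ℕ) :=
  (Fintype.piFinset fun _ : Fin n => Finset.range (M + 1)).map
    ⟨List.ofFn, List.ofFn_injective⟩

theorem mem_words {M n : ℕ} {L : List ℕ} :
    L ∈ words M n ↔ L.length = n ∧ ∀ x ∈ L, x ≤ M := by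
  simp only [words, Finset.mem_map, Fintype.mem_piFinset, Finset.mem_range,
    Function.Embedding.coeFn_mk]
  constructor
  · rintro ⟨f, hf, rfl⟩
    refine ⟨List.length_ofFn, fun x hx => ?_⟩
    obtain ⟨i, rfl⟩ := (List.mem_ofFn' f x).1 hx
    exact Nat.lt_succ_iff.1 (hf i)
  · rintro ⟨rfl, h⟩
    exact ⟨L.get, fun i => Nat.lt_succ_iff.2 (h _ (L.get_mem i)), List.ofFn_get L⟩

theorem sum_words_ofFn {R : Type*} [AddCommMonoid R] (M n : ℕ) (F : List ℕ → R) :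
    ∑ L ∈ words M n, F L =
      ∑ f ∈ Fintype.piFinset (fun _ : Fin n => Finset.range (M + 1)), F (List.ofFn f) := by
  simp [words]

theorem sum_words_pow_sum {R : Type*} [CommRing R] (q : R) (M n : ℕ) :
    ∑ L ∈ words M n, q ^ L.sum = QAnalog.qInt q (M + 1) ^ n := by
  rw [sum_words_ofFn]
  simp only [List.sum_ofFn, ← Finset.prod_pow_eq_pow_sum]
  rw [← Finset.prod_univ_sum (fun _ : Fin n => Finset.range (M + 1)) fun _ j => q ^ j]
  simp [QAnalog.qInt]

open Classical in
/-- The insertion of `v` as a fixed value is a bijection. -/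
theorem sum_words_hasFixed_succ {R : Type*} [CommRing R] (q : R) {M v : ℕ} (hv : v ≤ M) (n : ℕ)
    (S : Finset ℕ) (hvS : v ∉ S) :
    ∑ L ∈ words M (n + 1) with ∀ u ∈ insert v S, HasFixed u L, q ^ L.sum =
      q ^ v * ∑ L ∈ words M n with ∀ u ∈ S, HasFixed u L, q ^ L.sum := by
  rw [Finset.mul_sum]
  choose A B hAB hb using exists_balanced v
  symm
  refine Finset.sum_bij (fun L _ => A L ++ v :: B L) ?_ ?_ ?_ ?_
  · intro L hL
    simp only [Finset.mem_filter, mem_words] at hL ⊢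
    obtain ⟨⟨hl, hM⟩, hS⟩ := hL
    have hl' : (A L).length + (B L).length = n := by
      rw [← List.length_append, ← hAB, hl]
    refine ⟨⟨by simp; omega, fun x hx => ?_⟩, fun u hu => ?_⟩
    · by_cases hxv : x = v
      · rwa [hxv]
      · refine hM x ?_
        rw [hAB L]
        simpa [hxv] using hx
    · rw [hasFixed_insert (hb L), ← hAB]
      rcases Finset.mem_insert.1 hu with h | h
      · exact Or.inl h
      · exact Or.inr (hS u h)
  · intro L _ L' _ h
    rw [hAB L, hAB L']
    exact delete_unique h (hb L) (hb L')
  · intro L hL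
    simp only [Finset.mem_filter, mem_words] at hL
    obtain ⟨⟨hl, hM⟩, hS⟩ := hL
    obtain ⟨C, D, rfl, hCD⟩ := hS v (Finset.mem_insert_self v S)
    refine ⟨C ++ D, ?_, insert_unique (hAB _).symm (hb _) hCD⟩
    simp only [Finset.mem_filter, mem_words]
    refine ⟨⟨by simp at hl ⊢; omega, fun x hx => hM x ?_⟩, fun u hu => ?_⟩
    · simp at hx ⊢; tauto
    · exact ((hasFixed_insert hCD).1 (hS u (Finset.mem_insert_of_mem hu))).resolve_left
        fun h => hvS (h ▸ hu)
  · intro L _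
    conv_lhs => rw [hAB L]
    rw [← pow_add]
    congr 1
    simp only [List.sum_append, List.sum_cons]
    omega

open Classical in
theorem sum_words_hasFixed {R : Type*} [CommRing R] (q : R) (M : ℕ) (S : Finset ℕ)
    (hS : ∀ v ∈ S, v ≤ M) : ∀ n,
    ∑ L ∈ words M n with ∀ u ∈ S, HasFixed u L, q ^ L.sum =
      if S.card ≤ n then q ^ (∑ v ∈ S, v) * QAnalog.qInt q (M + 1) ^ (n - S.card) else 0 := by
  induction S using Finset.induction_on with
  | empty => intro n; simp [sum_words_pow_sum]
  | insert v S hvS ih =>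
    intro n
    rw [Finset.card_insert_of_notMem hvS, Finset.sum_insert hvS]
    cases n with
    | zero =>
      rw [if_neg (by omega)]
      refine Finset.sum_eq_zero fun L hL => ?_
      simp only [Finset.mem_filter, mem_words, List.length_eq_zero_iff] at hL
      obtain ⟨C, D, h, -⟩ := hL.2 v (Finset.mem_insert_self v S)
      rw [hL.1.1] at h
      simp at h
    | succ n =>
      rw [sum_words_hasFixed_succ q (hS v (Finset.mem_insert_self v S)) n S hvS,
        ih fun u hu => hS u (Finset.mem_insert_of_mem hu)]
      simp only [Nat.add_le_add_iff_right, Nat.add_sub_add_right, pow_add, mul_ite, mul_zero,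
        mul_assoc]

open Classical in
/-- Inclusion-exclusion over the sets of fixed values in `V`. -/
theorem sum_words_forall_not_hasFixed {R : Type*} [CommRing R] (q : R) (M n : ℕ) (V : Finset ℕ)
    (hV : ∀ v ∈ V, v ≤ M) :
    ∑ L ∈ words M n with ∀ v ∈ V, ¬ HasFixed v L, q ^ L.sum =
      ∑ k ∈ Finset.range (n + 1), (-1) ^ k *
        (∑ S ∈ V.powersetCard k, q ^ (∑ v ∈ S, v)) * QAnalog.qInt q (M + 1) ^ (n - k) := by
  have h1 : ∀ L : List ℕ, (if ∀ v ∈ V, ¬ HasFixed v L then q ^ L.sum else 0) =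
      ∑ S ∈ V.powerset, (-1 : R) ^ S.card * if ∀ u ∈ S, HasFixed u L then q ^ L.sum else 0 := by
    intro L
    -- The alternating sum over all subsets of the set of fixed values in `V` is 1 if that set is
    -- empty and 0 otherwise.
    have h2 := congrArg (Int.cast : ℤ → R)
      (Finset.sum_powerset_neg_one_pow_card (x := V.filter fun v => HasFixed v L))
    have h3 : (V.filter fun v => HasFixed v L).powerset =
        V.powerset.filter fun S => ∀ u ∈ S, HasFixed u L := by
      ext S
      simp only [Finset.mem_powerset, Finset.mem_filter, Finset.subset_iff]
      exact ⟨fun h => ⟨fun x hx => (h hx).1, fun x hx => (h hx).2⟩,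
        fun h x hx => ⟨h.1 hx, h.2 x hx⟩⟩
    simp only [h3, Finset.filter_eq_empty_iff] at h2
    push_cast at h2
    simp only [mul_ite, mul_zero]
    rw [← Finset.sum_filter, ← Finset.sum_mul, h2]
    split_ifs <;> simp
  rw [Finset.sum_filter, Finset.sum_congr rfl fun L _ => h1 L, Finset.sum_comm]
  simp only [← Finset.mul_sum, ← Finset.sum_filter]
  rw [Finset.sum_congr rfl fun S hS => by
    rw [sum_words_hasFixed q M S fun v hv => hV v (Finset.mem_powerset.1 hS hv)]]
  simp only [Finset.mul_sum, Finset.sum_mul, mul_ite, mul_zero]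
  rw [← Finset.sum_filter]
  rw [← Finset.sum_fiberwise_of_maps_to (g := Finset.card) (t := Finset.range (n + 1))
    fun S hS => Finset.mem_range.2 (Nat.lt_succ_of_le (Finset.mem_filter.1 hS).2)]
  refine Finset.sum_congr rfl fun k hk => ?_
  have : (V.powerset.filter fun S => S.card ≤ n).filter (fun S => S.card = k) =
      V.powersetCard k := by
    ext S
    simp only [Finset.mem_filter, Finset.mem_powerset, Finset.mem_powersetCard]
    have := Finset.mem_range.1 hk
    constructor
    · rintro ⟨⟨h1, -⟩, h2⟩; exact ⟨h1, h2⟩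
    · rintro ⟨h1, h2⟩; exact ⟨⟨h1, by omega⟩, h2⟩
  rw [this]
  refine Finset.sum_congr rfl fun S hS => ?_
  rw [(Finset.mem_powersetCard.1 hS).2, mul_assoc]

end FixedValue

/-! ### Subset sums and `q`-binomial coefficients. -/

namespace QAnalog

/-- The `q`-Pascal recursion, splitting subsets by whether they contain the largest element;
denominators are cleared so that no division is needed. -/
theorem sum_powersetCard_mul {R : Type*} [CommRing R] (q : R) (N : ℕ) : ∀ k, k ≤ N →
    (∑ S ∈ (Finset.range N).powersetCard k, q ^ (∑ v ∈ S, v)) *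
      (qFactorial q k * qFactorial q (N - k)) = q ^ k.choose 2 * qFactorial q N := by
  induction N with
  | zero => intro k hk; obtain rfl : k = 0 := by omega
            simp [qFactorial]
  | succ N ih =>
    intro k hk
    cases k with
    | zero => simp [qFactorial]
    | succ k =>
      have hd : Disjoint (Finset.powersetCard (k + 1) (Finset.range N))
          (Finset.image (insert N) (Finset.powersetCard k (Finset.range N))) := by
        rw [Finset.disjoint_left]
        intro S hS hS'
        obtain ⟨T, -, rfl⟩ := Finset.mem_image.1 hS'
        exact Finset.notMem_range_self
          ((Finset.mem_powersetCard.1 hS).1 (Finset.mem_insert_self N T))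
      have hN : ∀ S ∈ Finset.powersetCard k (Finset.range N), N ∉ S := fun S hS h =>
        Finset.notMem_range_self ((Finset.mem_powersetCard.1 hS).1 h)
      rw [Finset.range_add_one, Finset.powersetCard_succ_insert Finset.notMem_range_self,
        Finset.sum_union hd, Finset.sum_image fun S hS T hT h => by
          rw [← Finset.erase_insert (hN S hS), h, Finset.erase_insert (hN T hT)],
        Finset.sum_congr (s₁ := Finset.powersetCard k _) rfl fun S hS => by
          rw [Finset.sum_insert (hN S hS), pow_add],
        ← Finset.mul_sum]
      have hk' := ih k (by omega)
      rw [Nat.add_sub_add_right, Nat.choose_succ_succ', Nat.choose_one_right, pow_add]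
      rcases (Nat.le_of_succ_le_succ hk).eq_or_lt with rfl | hlt
      · rw [Finset.powersetCard_eq_empty.2 (by simp)]
        simp only [Finset.sum_empty, zero_add, qFactorial_succ]
        linear_combination (q ^ k * qInt q (k + 1)) * hk'
      · have hk1 := ih (k + 1) hlt
        obtain ⟨j, rfl⟩ : ∃ j, N = k + 1 + j := ⟨N - (k + 1), by omega⟩
        have e1 : k + 1 + j - (k + 1) = j := by omega
        have e2 : k + 1 + j - k = j + 1 := by omega
        rw [e1, Nat.choose_succ_succ', Nat.choose_one_right, pow_add] at hk1
        rw [e2] at hk' ⊢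
        -- `[N+1] = [N-k] + q^(N-k) [k+1]`: the two terms match the subsets without and with the
        -- element `N`.
        rw [qFactorial_succ q (k + 1 + j), show k + 1 + j + 1 = (j + 1) + (k + 1) by ring, qInt_add]
        simp only [qFactorial_succ] at hk1 hk' ⊢
        linear_combination qInt q (j + 1) * hk1 + q ^ (k + 1 + j) * qInt q (k + 1) * hk'

theorem sum_powersetCard_range (N k : ℕ) :
    ∑ S ∈ (Finset.range N).powersetCard k, (X : ℤ[X]) ^ (∑ v ∈ S, v) =
      X ^ k.choose 2 * qBinomial N k := by
  by_cases hk : k ≤ N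
  · refine mul_right_cancel₀ ((qFactorial_X_monic k).mul (qFactorial_X_monic (N - k))).ne_zero ?_
    rw [sum_powersetCard_mul _ _ _ hk, mul_assoc, qBinomial_mul hk]
  · rw [Finset.powersetCard_eq_empty.2 (by simpa using hk), qBinomial, if_neg hk]
    simp

theorem sum_powersetCard_image_mul (r N k : ℕ) (hr : r ≠ 0) :
    ∑ S ∈ ((Finset.range N).image (r * ·)).powersetCard k, (X : ℤ[X]) ^ (∑ v ∈ S, v) =
      X ^ (r * k.choose 2) * Polynomial.expand ℤ r (qBinomial N k) := by
  have h := congrArg (Polynomial.expand ℤ r) (sum_powersetCard_range N k)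
  rw [map_mul, map_pow, Polynomial.expand_X, ← pow_mul] at h
  rw [← h, map_sum]
  have hinj : Function.Injective (r * ·) := fun a b h => Nat.eq_of_mul_eq_mul_left
    (Nat.pos_of_ne_zero hr) h
  have := Finset.powersetCard_map ⟨_, hinj⟩ k (Finset.range N)
  rw [Finset.map_eq_image] at this
  change Finset.powersetCard k ((Finset.range N).image (r * ·)) = _ at this
  rw [this, Finset.sum_map]
  refine Finset.sum_congr rfl fun S _ => ?_
  simp [Finset.mapEmbedding_apply, Finset.mul_sum, ← pow_mul]

end QAnalog

/-! ### Colored permutations from windows and stable sorting. -/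

namespace ColoredPerm

variable {n r : ℕ}

theorem apply_eq (w : coloredPermGroup n r) (a : Fin n) (i : ZMod r) :
    (w : Equiv.Perm (ColoredInt n r)) (a, i) = ((letter w a).1, i + (letter w a).2) :=
  w.2 a _ _ rfl i

theorem ext_letter {w w' : coloredPermGroup n r} (h : ∀ i, letter w i = letter w' i) : w = w' := by
  ext1
  ext1 ⟨a, i⟩
  rw [apply_eq, apply_eq, h]

theorem letter_fst_injective (w : coloredPermGroup n r) :
    Function.Injective fun i => (letter w i).1 := by
  intro a b h
  -- The color of `a` is shifted so that both images also agree in color.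
  have := (w : Equiv.Perm (ColoredInt n r)).injective
    (a₁ := (a, (letter w b).2 - (letter w a).2)) (a₂ := (b, 0)) (by
      rw [apply_eq, apply_eq]
      exact Prod.ext h (by simp))
  exact congrArg Prod.fst this

/-- The permutation underlying a colored permutation. -/
noncomputable def perm (w : coloredPermGroup n r) : Equiv.Perm (Fin n) :=
  Equiv.ofBijective _ (Finite.injective_iff_bijective.1 (letter_fst_injective w))

theorem perm_apply (w : coloredPermGroup n r) (i : Fin n) : perm w i = (letter w i).1 := rfl

/-- The colored permutation with a given window. -/
def ofLetters (σ : Equiv.Perm (Fin n)) (c : Fin n → ZMod r) : coloredPermGroup n r :=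
  ⟨{ toFun := fun x => (σ x.1, x.2 + c x.1)
     invFun := fun x => (σ.symm x.1, x.2 - c (σ.symm x.1))
     left_inv := fun x => by simp
     right_inv := fun x => by simp }, by
    intro a b j h i
    simp only [Equiv.coe_fn_mk, Prod.mk.injEq, zero_add] at h ⊢
    rw [h.1, h.2]
    exact ⟨rfl, rfl⟩⟩

theorem letter_ofLetters (σ : Equiv.Perm (Fin n)) (c : Fin n → ZMod r) (i : Fin n) :
    letter (ofLetters σ c) i = (σ i, c i) := by
  simp [letter, ofLetters]

/-- Positions are compared by decreasing value of `f`, ties by increasing position. -/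
def Before (f : Fin n → ℕ) (a b : Fin n) : Prop := f b < f a ∨ (f a = f b ∧ a < b)

theorem Before.trans {f : Fin n → ℕ} {a b c : Fin n} (h : Before f a b) (h' : Before f b c) :
    Before f a c := by
  simp only [Before, Fin.lt_def] at *
  omega

theorem Before.asymm {f : Fin n → ℕ} {a b : Fin n} (h : Before f a b) : ¬ Before f b a := by
  simp only [Before, Fin.lt_def] at *
  omega

/-- The stable decreasing sort of `f`. -/
def sortDesc (f : Fin n → ℕ) : Equiv.Perm (Fin n) := Tuple.sort fun i => OrderDual.toDual (f i)

theorem eq_sortDesc_iff {f : Fin n → ℕ} {σ : Equiv.Perm (Fin n)} :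
    σ = sortDesc f ↔ ∀ i j, i < j → Before f (σ i) (σ j) := by
  rw [sortDesc, Tuple.eq_sort_iff]
  constructor
  · rintro ⟨h1, h2⟩ i j hij
    have h3 : f (σ j) ≤ f (σ i) := h1 hij.le
    rcases h3.eq_or_lt with h | h
    · exact Or.inr ⟨h.symm, h2 i j hij (congrArg OrderDual.toDual h.symm)⟩
    · exact Or.inl h
  · intro h
    refine ⟨fun i j hij => ?_, fun i j hij he => ?_⟩
    · rcases hij.eq_or_lt with rfl | hij
      · exact le_rfl
      · change f (σ j) ≤ f (σ i)
        rcases h i j hij with h | h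
        · exact h.le
        · exact h.1.ge
    · have he' : f (σ i) = f (σ j) := he
      rcases h i j hij with h | h
      · omega
      · exact h.2

theorem before_of_adjacent {f : Fin n → ℕ} {σ : Equiv.Perm (Fin n)}
    (h : ∀ i (hi : i + 1 < n), Before f (σ ⟨i, by omega⟩) (σ ⟨i + 1, hi⟩)) (i j : Fin n)
    (hij : i < j) : Before f (σ i) (σ j) := by
  have key : ∀ d k (hk : k + d + 1 < n), Before f (σ ⟨k, by omega⟩) (σ ⟨k + d + 1, hk⟩) := by
    intro d
    induction d with
    | zero => exact fun k hk => h k hk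
    | succ d ih => exact fun k hk => (ih k (by omega)).trans (h (k + d + 1) hk)
  have hij' : (i : ℕ) < j := hij
  have := key (j - i - 1) i (by omega)
  convert this using 3
  omega

/-! ### Quotient sequences and descents. -/

/-- The colored permutation that sorts `f`, colored by the residues of the values modulo `r`. -/
def ofWord (r : ℕ) (f : Fin n → ℕ) : coloredPermGroup n r :=
  ofLetters (sortDesc f) fun i => (f (sortDesc f i) : ZMod r)

theorem ofWord_eq_iff [NeZero r] {f : Fin n → ℕ} {w : coloredPermGroup n r} :
    ofWord r f = w ↔ perm w = sortDesc f ∧ ∀ i, f (perm w i) % r = (letter w i).2.val := by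
  constructor
  · rintro rfl
    have h : perm (ofWord r f) = sortDesc f := by
      ext i
      rw [perm_apply, ofWord, letter_ofLetters]
    refine ⟨h, fun i => ?_⟩
    rw [h, ofWord, letter_ofLetters, ZMod.val_natCast]
  · rintro ⟨h1, h2⟩
    refine ext_letter fun i => ?_
    rw [ofWord, letter_ofLetters, ← h1]
    refine Prod.ext (perm_apply w i) (ZMod.val_injective r ?_)
    rw [← h2, ZMod.val_natCast]

/-- The quotients modulo `r` of the values of `f` in the order of the window of `w`, preceded by
`m` and followed by zeros. -/
noncomputable def quot (m : ℕ) (w : coloredPermGroup n r) (f : Fin n → ℕ) : ℕ → ℕ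
  | 0 => m
  | i + 1 => if h : i < n then f (perm w ⟨i, h⟩) / r else 0

open Classical in
/-- The indicator function of the descent set. -/
noncomputable def descInd (w : coloredPermGroup n r) (i : ℕ) : ℕ :=
  if i ∈ descentSet w then 1 else 0

theorem mem_descentSet_zero (w : coloredPermGroup n r) (hn : 0 < n) :
    0 ∈ descentSet w ↔ (letter w ⟨0, hn⟩).2 ≠ 0 := by
  simp [descentSet, hn]

theorem mem_descentSet_succ (w : coloredPermGroup n r) {i : ℕ} (hi : i + 1 < n) :
    i + 1 ∈ descentSet w ↔ ColorLT (letter w ⟨i + 1, hi⟩) (letter w ⟨i, by omega⟩) := by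
  simp [descentSet, hi]

theorem descInd_of_le (w : coloredPermGroup n r) {i : ℕ} (hi : n ≤ i) : descInd w i = 0 := by
  simp [descInd, descentSet, hi.not_gt]

/-- If two consecutive quotients agree, sortedness makes the residues decrease weakly with ties in
increasing position, which is an ascent in the color order. So a descent forces a drop. At index 0,
a first quotient equal to `m` forces residue 0, since the letters are at most `r * m`. -/
theorem quot_succ_add_descInd_le [NeZero r] {m : ℕ} {w : coloredPermGroup n r} {f : Fin n → ℕ}
    (hw : ofWord r f = w) (hf : ∀ a, f a ≤ r * m) (i : ℕ) :
    quot m w f (i + 1) + descInd w i ≤ quot m w f i := by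
  obtain ⟨h1, h2⟩ := ofWord_eq_iff.1 hw
  have hr : 0 < r := Nat.pos_of_ne_zero (NeZero.ne r)
  by_cases hi : i < n
  swap
  · rw [descInd_of_le w (by omega)]
    simp [quot, hi]
  cases i with
  | zero =>
    simp only [quot, hi, dite_true, descInd, mem_descentSet_zero w hi]
    have h3 := h2 ⟨0, hi⟩
    have h4 := hf (perm w ⟨0, hi⟩)
    have h5 := Nat.div_add_mod (f (perm w ⟨0, hi⟩)) r
    split_ifs with h
    · rw [ne_eq, ← ZMod.val_eq_zero, ← h3] at h
      by_contra hlt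
      have := Nat.mul_le_mul_left r (show m ≤ f (perm w ⟨0, hi⟩) / r by omega)
      omega
    · exact Nat.div_le_of_le_mul h4
  | succ i =>
    have hi' : i < n := by omega
    simp only [quot, hi, hi', dite_true, descInd]
    have h3 := h2 ⟨i + 1, hi⟩
    have h3' := h2 ⟨i, hi'⟩
    have hb := eq_sortDesc_iff.1 h1 ⟨i, hi'⟩ ⟨i + 1, hi⟩ (by simp)
    have h5 := Nat.div_add_mod (f (perm w ⟨i + 1, hi⟩)) r
    have h5' := Nat.div_add_mod (f (perm w ⟨i, hi'⟩)) r
    have hle : f (perm w ⟨i + 1, hi⟩) ≤ f (perm w ⟨i, hi'⟩) := by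
      rcases hb with hb | hb
      · exact hb.le
      · exact hb.1.ge
    have hle' := Nat.div_le_div_right (c := r) hle
    split_ifs with h
    · rcases hle'.eq_or_lt with he | hlt
      · exfalso
        rw [mem_descentSet_succ w hi] at h
        simp only [ColorLT, ← h3, ← h3', ← perm_apply, Fin.lt_def] at h
        simp only [Before, Fin.lt_def] at hb
        rw [he] at h5
        omega
      · omega
    · omega

/-- Converse of `quot_succ_add_descInd_le`: a drop in quotient outweighs any residues, and without a
drop there is no descent, so the letters are already in sorted order. The bound `r * m` need only be
checked on the first, largest letter. -/
theorem ofWord_eq_of_quot [NeZero r] {m : ℕ} {w : coloredPermGroup n r} {f : Fin n → ℕ}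
    (h2 : ∀ i, f (perm w i) % r = (letter w i).2.val)
    (hq : ∀ i, quot m w f (i + 1) + descInd w i ≤ quot m w f i) :
    ofWord r f = w ∧ ∀ a, f a ≤ r * m := by
  have hr : 0 < r := Nat.pos_of_ne_zero (NeZero.ne r)
  have hb : ∀ i j, i < j → Before f (perm w i) (perm w j) := by
    refine before_of_adjacent fun i hi => ?_
    have hi' : i < n := by omega
    have h := hq (i + 1)
    simp only [quot, hi, hi', dite_true, descInd] at h
    have h3 := h2 ⟨i + 1, hi⟩
    have h3' := h2 ⟨i, hi'⟩
    have h5 := Nat.div_add_mod (f (perm w ⟨i + 1, hi⟩)) r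
    have h5' := Nat.div_add_mod (f (perm w ⟨i, hi'⟩)) r
    have hm := Nat.mod_lt (f (perm w ⟨i + 1, hi⟩)) hr
    have hne : (perm w ⟨i + 1, hi⟩ : ℕ) ≠ perm w ⟨i, hi'⟩ := by
      simp [Fin.val_inj]
    rcases (le_of_add_le_left h).eq_or_lt with he | hlt
    · have hn : ¬ ColorLT (letter w ⟨i + 1, hi⟩) (letter w ⟨i, hi'⟩) := by
        intro hc
        rw [if_pos ((mem_descentSet_succ w hi).2 hc)] at h
        omega
      simp only [ColorLT, ← h3, ← h3', ← perm_apply, Fin.lt_def] at hn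
      simp only [Before, Fin.lt_def]
      rw [he] at h5
      omega
    · left
      have := Nat.mul_le_mul_left r hlt
      rw [Nat.succ_eq_add_one, mul_add] at this
      omega
  refine ⟨ofWord_eq_iff.2 ⟨eq_sortDesc_iff.2 hb, h2⟩, fun a => ?_⟩
  have hn : 0 < n := a.pos
  have h0 : f (perm w ⟨0, hn⟩) ≤ r * m := by
    have h := hq 0
    simp only [quot, hn, dite_true, descInd, mem_descentSet_zero w hn] at h
    have h3 := h2 ⟨0, hn⟩
    have h5 := Nat.div_add_mod (f (perm w ⟨0, hn⟩)) r
    have hm := Nat.mod_lt (f (perm w ⟨0, hn⟩)) hr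
    split_ifs at h with hc
    · have := Nat.mul_le_mul_left r h
      rw [mul_add] at this
      omega
    · rw [ne_eq, not_not, ← ZMod.val_eq_zero, ← h3] at hc
      have := Nat.mul_le_mul_left r h
      rw [add_zero] at this
      omega
  obtain ⟨i, rfl⟩ := (perm w).surjective a
  rcases Nat.eq_zero_or_pos i with hi | hi
  · have : i = ⟨0, hn⟩ := Fin.ext hi
    rwa [this]
  · rcases hb ⟨0, hn⟩ i hi with h | h
    · omega
    · omega

/-! ### Fixed points of the sort and fixed values. -/

theorem card_before (f : Fin n → ℕ) (a : Fin n) [DecidableRel (Before f)] :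
    (Finset.univ.filter fun b => Before f b (sortDesc f a)).card = a := by
  have h : (Finset.univ.filter fun b => Before f b (sortDesc f a)) =
      (Finset.Iio a).map (sortDesc f).toEmbedding := by
    ext b
    obtain ⟨j, rfl⟩ := (sortDesc f).surjective b
    simp only [Finset.mem_filter, Finset.mem_univ, true_and, Finset.mem_map_equiv,
      Equiv.symm_apply_apply, Finset.mem_Iio]
    have hs := eq_sortDesc_iff.1 (rfl : sortDesc f = sortDesc f)
    refine ⟨fun h => ?_, hs j a⟩
    by_contra hja
    rcases (not_lt.1 hja).eq_or_lt with rfl | hlt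
    · exact h.asymm h
    · exact h.asymm (hs a j hlt)
  rw [h, Finset.card_map, Fin.card_Iio]

theorem sortDesc_apply_eq_self_iff (f : Fin n → ℕ) (a : Fin n) :
    sortDesc f a = a ↔ (Finset.univ.filter fun b => b < a ∧ f b < f a).card =
      (Finset.univ.filter fun b => a < b ∧ f a < f b).card := by
  classical
  have h1 : sortDesc f a = a ↔ (Finset.univ.filter fun b => Before f b a).card = a := by
    constructor
    · intro h
      have := card_before f a
      rwa [h] at this
    · intro h
      obtain ⟨j, rfl⟩ := (sortDesc f).surjective a
      exact congrArg _ (Fin.ext (h.symm.trans (card_before f j)))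
  -- Positions sorted before `a` are those left of `a`, minus the left ones with smaller value, plus
  -- the right ones with larger value.
  have h2 : (Finset.univ.filter fun b => Before f b a).card +
      (Finset.univ.filter fun b => b < a ∧ f b < f a).card =
      (Finset.univ.filter fun b => b < a).card +
      (Finset.univ.filter fun b => a < b ∧ f a < f b).card := by
    simp only [Finset.card_filter, ← Finset.sum_add_distrib]
    refine Finset.sum_congr rfl fun b _ => ?_
    simp only [Before, Fin.lt_def]
    by_cases hab : b = a
    · subst hab; simp
    · have : (b : ℕ) ≠ a := fun h => hab (Fin.ext h)
      split_ifs <;> omega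
  have h3 : (Finset.univ.filter fun b => b < a).card = a := by
    rw [Finset.filter_gt_eq_Iio, Fin.card_Iio]
  rw [h1]
  omega

theorem countP_take_ofFn {α : Type*} (p : α → Bool) {n : ℕ} : ∀ (f : Fin n → α) (k : ℕ),
    ((List.ofFn f).take k).countP p =
      (Finset.univ.filter fun b : Fin n => (b : ℕ) < k ∧ p (f b)).card := by
  induction n with
  | zero => intro f k; simp
  | succ n ih =>
    intro f k
    cases k with
    | zero => simp
    | succ k =>
      rw [List.ofFn_succ, List.take_succ_cons, List.countP_cons, ih, Fin.card_filter_univ_succ]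
      split_ifs <;> simp_all [add_comm]

theorem countP_drop_ofFn {α : Type*} (p : α → Bool) {n : ℕ} (f : Fin n → α) (k : ℕ) :
    ((List.ofFn f).drop k).countP p =
      (Finset.univ.filter fun b : Fin n => k ≤ (b : ℕ) ∧ p (f b)).card := by
  have h1 := countP_take_ofFn p f n
  rw [List.take_of_length_le (by simp)] at h1
  have h2 : (List.ofFn f).countP p =
      ((List.ofFn f).take k).countP p + ((List.ofFn f).drop k).countP p := by
    rw [← List.countP_append, List.take_append_drop]
  rw [h1, countP_take_ofFn] at h2
  have h3 : (Finset.univ.filter fun b : Fin n => (b : ℕ) < n ∧ p (f b)).card =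
      (Finset.univ.filter fun b : Fin n => (b : ℕ) < k ∧ p (f b)).card +
      (Finset.univ.filter fun b : Fin n => k ≤ (b : ℕ) ∧ p (f b)).card := by
    simp only [Finset.card_filter, ← Finset.sum_add_distrib]
    refine Finset.sum_congr rfl fun b _ => ?_
    by_cases hp : p (f b) = true <;> by_cases hb : (b : ℕ) < k <;> simp [hp, hb]
  omega

theorem hasFixed_ofFn_iff (f : Fin n → ℕ) (v : ℕ) :
    FixedValue.HasFixed v (List.ofFn f) ↔ ∃ a, f a = v ∧ sortDesc f a = a := by
  have key : ∀ a : Fin n, FixedValue.Balanced (f a) ((List.ofFn f).take a)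
      ((List.ofFn f).drop (a + 1)) ↔ sortDesc f a = a := by
    intro a
    rw [FixedValue.Balanced, countP_take_ofFn, countP_drop_ofFn, sortDesc_apply_eq_self_iff]
    simp only [decide_eq_true_eq, Fin.lt_def, Nat.succ_le_iff]
  constructor
  · rintro ⟨A, B, h, hb⟩
    have hlen := congrArg List.length h
    simp only [List.length_ofFn, List.length_append, List.length_cons] at hlen
    have ha : A.length < n := by omega
    have hv : f ⟨A.length, ha⟩ = v := by
      have : (List.ofFn f)[A.length]'(by simpa using ha) = v := by simp [h]
      simpa using this
    refine ⟨⟨A.length, ha⟩, hv, (key _).1 ?_⟩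
    rw [hv, h]
    simpa using hb
  · rintro ⟨a, rfl, ha⟩
    refine ⟨_, _, ?_, (key a).2 ha⟩
    have hl : (a : ℕ) < (List.ofFn f).length := by simp
    conv_lhs => rw [← List.take_append_drop a (List.ofFn f), List.drop_eq_getElem_cons hl]
    simp

theorem ofWord_mem_derangements_iff [NeZero r] {m : ℕ} {f : Fin n → ℕ}
    (hf : ∀ a, f a ≤ r * m) : ofWord r f ∈ derangements n r ↔
      ∀ v ∈ (Finset.range (m + 1)).image (r * ·), ¬ FixedValue.HasFixed v (List.ofFn f) := by
  have hr : 0 < r := Nat.pos_of_ne_zero (NeZero.ne r)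
  simp only [derangements, Finset.mem_filter, Finset.mem_univ, true_and, ofWord, letter_ofLetters,
    Prod.mk.injEq, not_and, ne_eq, Finset.mem_image, Finset.mem_range, hasFixed_ofFn_iff,
    not_exists, forall_exists_index, and_imp]
  constructor
  · rintro h v s hs rfl a ha hfa
    refine h a hfa ?_
    rw [hfa, ha]
    simp
  · intro h a hfa h0
    -- Color 0 means that the value is a multiple of `r`; the bound on `f` then places it in the
    -- finite set of values considered.
    rw [hfa, ZMod.natCast_eq_zero_iff] at h0
    obtain ⟨s, hs⟩ := h0
    have := hf a
    rw [hs] at this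
    exact h _ s (Nat.lt_succ_of_le (Nat.le_of_mul_le_mul_left this hr)) rfl a hs hfa

end ColoredPerm

/-! ### Expansion of the reciprocal `q`-Pochhammer symbol. -/

namespace QAnalog

theorem one_sub_X_mul_C_mul_mk {R : Type*} [CommRing R] (a : R) :
    (1 - PowerSeries.X * PowerSeries.C a) * PowerSeries.mk (fun j => a ^ j) = 1 := by
  ext j
  cases j with
  | zero => simp [sub_mul, mul_assoc]
  | succ j =>
    simp [sub_mul, mul_assoc, PowerSeries.coeff_succ_X_mul, PowerSeries.coeff_one, pow_succ']

theorem qPochhammerInv_eq_prod {R : Type*} [CommRing R] (p : R) (N : ℕ) :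
    qPochhammerInv p N = ∏ i ∈ Finset.range N, PowerSeries.mk fun j => (p ^ i) ^ j := by
  refine (left_inv_eq_right_inv ?_ (qPochhammer_mul_inv p N)).symm
  rw [qPochhammer, ← Finset.prod_mul_distrib]
  refine Finset.prod_eq_one fun i _ => ?_
  rw [mul_comm, ← map_pow, one_sub_X_mul_C_mul_mk]

/-- The coefficients of a shifted `1 / (x; p)_N`, as sums over compositions with given lower
bounds of the parts. -/
theorem coeff_X_pow_mul_qPochhammerInv {R : Type*} [CommRing R] (p : R) (N m : ℕ) (δ : ℕ → ℕ) :
    PowerSeries.coeff m (PowerSeries.X ^ (∑ i ∈ Finset.range N, δ i) *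
        PowerSeries.C (p ^ (∑ i ∈ Finset.range N, i * δ i)) * qPochhammerInv p N) =
      ∑ c ∈ (Finset.range N).finsuppAntidiag m with ∀ i ∈ Finset.range N, δ i ≤ c i,
        p ^ (∑ i ∈ Finset.range N, i * c i) := by
  -- The monomial is distributed over the geometric series: the factor `x^(δ i) p^(i * δ i)` makes
  -- the `i`-th series start at exponent `δ i`.
  have h : PowerSeries.X ^ (∑ i ∈ Finset.range N, δ i) *
        PowerSeries.C (p ^ (∑ i ∈ Finset.range N, i * δ i)) * qPochhammerInv p N =
      ∏ i ∈ Finset.range N, PowerSeries.mk fun j => if δ i ≤ j then p ^ (i * j) else 0 := by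
    rw [qPochhammerInv_eq_prod, ← Finset.prod_pow_eq_pow_sum, ← Finset.prod_pow_eq_pow_sum,
      map_prod, ← Finset.prod_mul_distrib, ← Finset.prod_mul_distrib]
    refine Finset.prod_congr rfl fun i _ => ?_
    ext j
    rw [mul_assoc, PowerSeries.coeff_X_pow_mul', PowerSeries.coeff_C_mul, PowerSeries.coeff_mk,
      PowerSeries.coeff_mk]
    split_ifs with hj
    · rw [← pow_mul, ← pow_add, ← mul_add, Nat.add_sub_cancel' hj]
    · rfl
  rw [h, PowerSeries.coeff_prod, Finset.sum_filter]
  refine Finset.sum_congr rfl fun c _ => ?_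
  simp only [PowerSeries.coeff_mk]
  split_ifs with hc
  · rw [← Finset.prod_pow_eq_pow_sum]
    exact Finset.prod_congr rfl fun i hi => if_pos (hc i hi)
  · push Not at hc
    obtain ⟨i, hi, hlt⟩ := hc
    exact Finset.prod_eq_zero hi (if_neg hlt.not_ge)

end QAnalog

theorem sum_Ico_tsub_succ {t : ℕ → ℕ} (ht : ∀ i, t (i + 1) ≤ t i) {N : ℕ} (hN : t N = 0) {i : ℕ}
    (hi : i ≤ N) : ∑ j ∈ Finset.Ico i N, (t j - t (j + 1)) = t i := by
  induction hi using Nat.decreasingInduction with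
  | self => simp [hN]
  | of_succ i hi ih =>
    rw [Finset.sum_eq_sum_Ico_succ_bot hi, ih]
    have := ht i
    omega

theorem sum_range_sum_Ico_succ (n : ℕ) (c : ℕ → ℕ) :
    ∑ i ∈ Finset.range n, ∑ j ∈ Finset.Ico (i + 1) (n + 1), c j =
      ∑ j ∈ Finset.range (n + 1), j * c j := by
  rw [Finset.sum_comm' (t' := Finset.range (n + 1)) (s' := fun j => Finset.range j)]
  · simp
  · intro i j
    simp only [Finset.mem_range, Finset.mem_Ico]
    omega

/-! ### The words sorted by a given colored permutation. -/

namespace ColoredPerm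

variable {n r : ℕ}

theorem sum_descInd (w : coloredPermGroup n r) :
    ∑ i ∈ Finset.range (n + 1), descInd w i = des w := by
  classical
  rw [des, Finset.card_eq_sum_ones, Finset.sum_range_succ, descInd_of_le w le_rfl, add_zero]
  simp only [descInd]
  rw [← Finset.sum_filter]
  refine Finset.sum_congr ?_ fun _ _ => rfl
  ext i
  simp only [Finset.mem_filter, and_iff_right_iff_imp]
  exact fun h => (Finset.mem_filter.1 h).1

theorem sum_mul_descInd (w : coloredPermGroup n r) :
    ∑ i ∈ Finset.range (n + 1), i * descInd w i = maj w := by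
  classical
  rw [maj, Finset.sum_range_succ, descInd_of_le w le_rfl, mul_zero, add_zero]
  simp only [descInd, mul_ite, mul_one, mul_zero]
  rw [← Finset.sum_filter]
  refine Finset.sum_congr ?_ fun _ _ => rfl
  ext i
  simp only [Finset.mem_filter, and_iff_right_iff_imp]
  exact fun h => (Finset.mem_filter.1 h).1

/-- The word with given colored permutation and given differences of quotients. -/
noncomputable def wordOf (w : coloredPermGroup n r) (c : ℕ → ℕ) (a : Fin n) : ℕ :=
  r * (∑ j ∈ Finset.Ico ((perm w).symm a + 1 : ℕ) (n + 1), c j) +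
    (letter w ((perm w).symm a)).2.val

theorem wordOf_perm (w : coloredPermGroup n r) (c : ℕ → ℕ) (i : Fin n) :
    wordOf w c (perm w i) =
      r * (∑ j ∈ Finset.Ico (i + 1 : ℕ) (n + 1), c j) + (letter w i).2.val := by
  simp [wordOf]

/-- The difference `c j` enters the quotients of the first `j` window positions, so it is counted
`j` times. -/
theorem sum_wordOf (w : coloredPermGroup n r) (c : ℕ → ℕ) :
    ∑ a, wordOf w c a = r * (∑ j ∈ Finset.range (n + 1), j * c j) + csum w := by
  rw [← Equiv.sum_comp (perm w)]
  simp only [wordOf_perm, Finset.sum_add_distrib, ← Finset.mul_sum, csum]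
  rw [Fin.sum_univ_eq_sum_range (fun i => ∑ j ∈ Finset.Ico (i + 1) (n + 1), c j) n,
    sum_range_sum_Ico_succ]

theorem wordOf_perm_mod [NeZero r] (w : coloredPermGroup n r) (c : ℕ → ℕ) (i : Fin n) :
    wordOf w c (perm w i) % r = (letter w i).2.val := by
  rw [wordOf_perm, Nat.mul_add_mod, Nat.mod_eq_of_lt (ZMod.val_lt _)]

theorem quot_wordOf [NeZero r] {m : ℕ} (w : coloredPermGroup n r) {c : ℕ → ℕ}
    (hc : ∑ j ∈ Finset.range (n + 1), c j = m) (i : ℕ) :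
    quot m w (wordOf w c) i = ∑ j ∈ Finset.Ico i (n + 1), c j := by
  have hr : 0 < r := Nat.pos_of_ne_zero (NeZero.ne r)
  cases i with
  | zero => rw [← Finset.range_eq_Ico, hc, quot]
  | succ i =>
    by_cases hi : i < n
    · simp only [quot, hi, dite_true, wordOf_perm]
      rw [Nat.mul_add_div hr, Nat.div_eq_of_lt (ZMod.val_lt _), add_zero]
    · simp only [quot, hi, dite_false]
      rw [Finset.Ico_eq_empty (by omega), Finset.sum_empty]

theorem quot_of_gt {m : ℕ} (w : coloredPermGroup n r) (f : Fin n → ℕ) {i : ℕ} (hi : n < i) :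
    quot m w f i = 0 := by
  cases i with
  | zero => omega
  | succ i => simp [quot, show ¬ i < n by omega]

/-- The words sorted by a given colored permutation contribute one summand of the numerator. -/
theorem sum_ofWord_eq [NeZero r] {R : Type*} [CommRing R] (q : R) (m : ℕ)
    (w : coloredPermGroup n r) [DecidableEq (coloredPermGroup n r)] :
    ∑ f ∈ Fintype.piFinset (fun _ : Fin n => Finset.range (r * m + 1)) with ofWord r f = w,
        q ^ (∑ a, f a) =
      PowerSeries.coeff m (PowerSeries.X ^ des w * PowerSeries.C (q ^ fmaj w) *
        QAnalog.qPochhammerInv (q ^ r) (n + 1)) := by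
  have hsplit : PowerSeries.X ^ des w * PowerSeries.C (q ^ fmaj w) *
        QAnalog.qPochhammerInv (q ^ r) (n + 1) =
      PowerSeries.C (q ^ csum w) * (PowerSeries.X ^ des w * PowerSeries.C ((q ^ r) ^ maj w) *
        QAnalog.qPochhammerInv (q ^ r) (n + 1)) := by
    rw [fmaj, pow_add, pow_mul, map_mul]
    ring
  rw [hsplit, PowerSeries.coeff_C_mul, ← sum_descInd, ← sum_mul_descInd,
    QAnalog.coeff_X_pow_mul_qPochhammerInv, Finset.mul_sum]
  symm
  have hmono : ∀ f, (∀ i, quot m w f (i + 1) + descInd w i ≤ quot m w f i) →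
      ∀ i, quot m w f (i + 1) ≤ quot m w f i := fun f h i => le_of_add_le_left (h i)
  -- Compositions of `m` into `n + 1` parts correspond to words through `c i = quot i - quot (i +
  -- 1)`. The sum telescopes from `quot 0 = m` to `quot (n + 1) = 0`, and `descInd` gives the lower
  -- bounds.
  refine Finset.sum_nbij' (fun c => wordOf w c)
    (fun f => Finsupp.onFinset (Finset.range (n + 1))
      (fun i => quot m w f i - quot m w f (i + 1)) ?_) ?_ ?_ ?_ ?_ ?_
  · intro i hi
    by_contra h
    rw [Finset.mem_range, not_lt] at h
    exact hi (by rw [quot_of_gt w f (by omega), zero_tsub])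
  · intro c hc
    simp only [Finset.mem_filter, Finset.mem_finsuppAntidiag, Finset.mem_range] at hc
    obtain ⟨⟨hm, hs⟩, hd⟩ := hc
    obtain ⟨h1, h2⟩ := ofWord_eq_of_quot (m := m) (wordOf_perm_mod w c) fun i => by
      rw [quot_wordOf w hm, quot_wordOf w hm]
      by_cases hi : i < n + 1
      · rw [Finset.sum_eq_sum_Ico_succ_bot hi, add_comm]
        exact Nat.add_le_add_right (hd i hi) _
      · rw [descInd_of_le w (by omega), Finset.Ico_eq_empty (by omega)]
        simp
    simp only [Finset.mem_filter, Fintype.mem_piFinset, Finset.mem_range]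
    exact ⟨fun a => Nat.lt_succ_of_le (h2 a), h1⟩
  · intro f hf
    simp only [Finset.mem_filter, Fintype.mem_piFinset, Finset.mem_range, Nat.lt_succ_iff] at hf
    have hq := quot_succ_add_descInd_le hf.2 hf.1
    simp only [Finset.mem_filter, Finset.mem_finsuppAntidiag, Finsupp.onFinset_apply]
    refine ⟨⟨?_, Finsupp.support_onFinset_subset⟩, fun i _ => ?_⟩
    · have h := sum_Ico_tsub_succ (hmono f hq) (quot_of_gt w f n.lt_succ_self) (Nat.zero_le _)
      rw [← Finset.range_eq_Ico] at h
      exact h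
    · have := hq i
      omega
  · intro c hc
    simp only [Finset.mem_filter, Finset.mem_finsuppAntidiag] at hc
    ext i
    rw [Finsupp.onFinset_apply, quot_wordOf w hc.1.1, quot_wordOf w hc.1.1]
    by_cases hi : i < n + 1
    · rw [Finset.sum_eq_sum_Ico_succ_bot hi]
      omega
    · rw [Finset.Ico_eq_empty (by omega), Finset.sum_empty, zero_tsub]
      symm
      by_contra h
      exact hi (Finset.mem_range.1 (hc.1.2 (Finsupp.mem_support_iff.2 h)))
  · intro f hf
    simp only [Finset.mem_filter, Fintype.mem_piFinset, Finset.mem_range, Nat.lt_succ_iff] at hf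
    have hq := quot_succ_add_descInd_le hf.2 hf.1
    ext a
    obtain ⟨i, rfl⟩ := (perm w).surjective a
    rw [wordOf_perm]
    simp only [Finsupp.onFinset_apply]
    rw [sum_Ico_tsub_succ (hmono f hq) (quot_of_gt w f (by omega)) (by omega),
      ← (ofWord_eq_iff.1 hf.2).2 i]
    simp only [quot, i.2, dite_true, Fin.eta]
    exact Nat.div_add_mod _ _
  · intro c _
    rw [sum_wordOf, pow_add, ← pow_mul, mul_comm]

end ColoredPerm

/-- The identity holds in `ℤ[q]⟦x⟧`, where `q = Polynomial.X` and `x = PowerSeries.X`;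
`Polynomial.expand ℤ r` is the substitution of `q ^ r` for `q`. -/
theorem theorem4p6 (n r : ℕ) [NeZero r] (hn : 0 < n) :
    (PowerSeries.mk fun m : ℕ =>
      ∑ k ∈ Finset.range (n + 1),
        (-1 : ℤ[X]) ^ k * X ^ (r * k.choose 2) *
          Polynomial.expand ℤ r (QAnalog.qBinomial (m + 1) k) *
            QAnalog.qInt (X : ℤ[X]) (r * m + 1) ^ (n - k)) =
    (∑ w ∈ ColoredPerm.derangements n r,
      (PowerSeries.X : PowerSeries ℤ[X]) ^ ColoredPerm.des w *
        PowerSeries.C ((X : ℤ[X]) ^ ColoredPerm.fmaj w)) *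
      QAnalog.qPochhammerInv ((X : ℤ[X]) ^ r) (n + 1) := by
  classical
  ext1 m
  have hV : ∀ v ∈ (Finset.range (m + 1)).image (r * ·), v ≤ r * m := by
    intro v hv
    obtain ⟨s, hs, rfl⟩ := Finset.mem_image.1 hv
    exact Nat.mul_le_mul_left r (Nat.lt_succ_iff.1 (Finset.mem_range.1 hs))
  -- The values to be avoided are the multiples of `r` among the letters.
  have hL := FixedValue.sum_words_forall_not_hasFixed (X : ℤ[X]) (r * m) n _ hV
  simp only [QAnalog.sum_powersetCard_image_mul r _ _ (NeZero.ne r), ← mul_assoc] at hL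
  rw [PowerSeries.coeff_mk, ← hL, Finset.sum_filter, FixedValue.sum_words_ofFn,
    ← Finset.sum_filter, Finset.sum_mul, map_sum]
  simp only [List.sum_ofFn, ← ColoredPerm.sum_ofWord_eq]
  -- The remaining words are grouped by their colored permutation. A fibre over a derangement meets
  -- no forbidden word, so the condition on fixed values can be dropped there.
  rw [← Finset.sum_fiberwise_of_maps_to (g := ColoredPerm.ofWord r)
    (t := ColoredPerm.derangements n r)]
  · refine Finset.sum_congr rfl fun w hw => Finset.sum_congr ?_ fun _ _ => rfl
    ext f
    simp only [Finset.mem_filter, Fintype.mem_piFinset, Finset.mem_range, Nat.lt_succ_iff]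
    constructor
    · rintro ⟨⟨h1, -⟩, h2⟩
      exact ⟨h1, h2⟩
    · rintro ⟨h1, h2⟩
      exact ⟨⟨h1, (ColoredPerm.ofWord_mem_derangements_iff h1).1 (h2 ▸ hw)⟩, h2⟩
  · intro f hf
    simp only [Finset.mem_filter, Fintype.mem_piFinset, Finset.mem_range, Nat.lt_succ_iff] at hf
    exact (ColoredPerm.ofWord_mem_derangements_iff hf.1).2 hf.2
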